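/- **Setting.** Fix denumerably many propositional variables and a countable language extending that of $\mathrm{MTL}$ (primitive connectives $\wedge, \&, \to, \overline{0}$) by countably many additional connectives of finite arity. Put $\neg\varphi := \varphi\to\overline{0}$, $\overline{1} := \neg\overline{0}$, $\varphi\vee\psi := ((\varphi\to\psi)\to\psi)\wedge((\psi\to\varphi)\to\varphi)$ and $\varphi\leftrightarrow\psi := (\varphi\to\psi)\wedge(\psi\to\varphi)$. A *core expansion of $\mathrm{MTL}$* is a finitary logic $\mathrm{L}$ in this language, given by a set of schematic axioms and finitary rules, in which all axioms of $\mathrm{MTL}$ and modus ponens are derivable, and such that for every additional connective $c$ and every argument place of $c$, $$\varphi\to\psi,\ \psi\to\varphi\ \vdash_{\mathrm{L}}\ c(\dots,\varphi,\dots)\to c(\dots,\psi,\dots).$$ An *$\mathrm{L}$-algebra* is an $\mathrm{MTL}$-algebra (a commutative bounded integral residuated lattice satisfying $(x\to y)\vee(y\to x)=1$) with an operation interpreting each additional connective, such that whenever $T\vdash_{\mathrm{L}}\varphi$, every evaluation giving value $1$ to all formulas of $T$ gives value $1$ to $\varphi$. An *$\mathrm{L}$-chain* is a linearly ordered $\mathrm{L}$-algebra;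 a *real $\mathrm{L}$-chain* is one whose underlying ordered set is $[0,1]$ with its usual order. $\mathrm{L}$ is *strongly complete* with respect to a class $\mathbb{K}$ of $\mathrm{L}$-algebras if for every (possibly infinite) set $T$ of formulas and every formula $\varphi$: $T\vdash_{\mathrm{L}}\varphi$ if and only if, for every algebra in $\mathbb{K}$, every evaluation giving value $1$ to all formulas of $T$ gives value $1$ to $\varphi$. $\mathrm{L}$ is *semilinear* if it is strongly complete with respect to all $\mathrm{L}$-chains, and has the *strong real completeness property* ($\mathrm{S}\mathcal{R}\mathrm{C}$) if it is strongly complete with respect to all real $\mathrm{L}$-chains. For a core expansion $\mathrm{L}$ of $\mathrm{MTL}$, the logic $\mathrm{L}_\circ$ is obtained by adding a new unary connective $\circ$, keeping all axioms and rules of $\mathrm{L}$ (as schemata over the expanded language), and adding the axioms $$\text{(A1)}\ \neg(\varphi\wedge\neg\varphi\wedge\circ\varphi),\qquad \text{(A2)}\ \circ\overline{1},\qquad \text{(A3)}\ \circ\overline{0}$$ and the rules $$\text{(Cong)}\ \frac{(\varphi\leftrightarrow\psi)\vee\delta}{(\circ\varphi\leftrightarrow\circ\psi)\vee\delta},\qquad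 \text{(Coh)}\ \frac{(\neg\neg\varphi\wedge(\varphi\to\psi))\vee\delta}{(\circ\varphi\to\circ\psi)\vee\delta}.$$ **Theorem (Strong real completeness).** Let $\mathrm{L}$ be a semilinear core expansion of $\mathrm{MTL}$ in a countable language. Then $\mathrm{L}_\circ$ has the $\mathrm{S}\mathcal{R}\mathrm{C}$ if and only if $\mathrm{L}$ has the $\mathrm{S}\mathcal{R}\mathrm{C}$. -/

import Mathlib

universe u

/-- A propositional language extending that of MTL: its additional connectives with their
(finite) arities. The MTL connectives are built into `Formula` below. -/
structure Signature where
  Op : Type u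
  arity : Op → ℕ

/-- Formulas over the variables `p₀, p₁, …`, the primitive connectives `0̄, ∧, &, →` of MTL, and
the additional connectives of the signature `S`. -/
inductive Formula (S : Signature.{u}) : Type u
  | var : ℕ → Formula S
  | bot : Formula S
  | and : Formula S → Formula S → Formula S
  | conj : Formula S → Formula S → Formula S
  | imp : Formula S → Formula S → Formula S
  | op : (c : S.Op) → (Fin (S.arity c) → Formula S) → Formula S

namespace Formula

variable {S : Signature.{u}}

/-- `¬φ := φ → 0̄` -/
def neg (φ : Formula S) : Formula S := imp φ bot

/-- `1̄ := ¬0̄` -/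
def top : Formula S := neg bot

/-- `φ ∨ ψ := ((φ → ψ) → ψ) ∧ ((ψ → φ) → φ)` -/
def or (φ ψ : Formula S) : Formula S := and (imp (imp φ ψ) ψ) (imp (imp ψ φ) φ)

/-- `φ ↔ ψ := (φ → ψ) ∧ (ψ → φ)` -/
def iff (φ ψ : Formula S) : Formula S := and (imp φ ψ) (imp ψ φ)

/-- Simultaneous substitution of formulas for variables. -/
def subst (σ : ℕ → Formula S) : Formula S → Formula S
  | var n => σ n
  | bot => bot
  | and φ ψ => and (φ.subst σ) (ψ.subst σ)
  | conj φ ψ => conj (φ.subst σ) (ψ.subst σ)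
  | imp φ ψ => imp (φ.subst σ) (ψ.subst σ)
  | op c a => op c (fun i => (a i).subst σ)

end Formula

/-- A finitary inference rule; axioms are the rules without premises. -/
structure Rule (S : Signature.{u}) where
  prem : List (Formula S)
  concl : Formula S

/-- A finitary logic, given by an axiomatization: a set of (schematic) axioms and finitary rules. -/
abbrev Logic (S : Signature.{u}) := Set (Rule S)

/-- `Derives L T φ` is `T ⊢_L φ`: there is a derivation of `φ` from `T` that uses substitution
instances of the axioms and rules of `L`. -/
inductive Derives {S : Signature.{u}} (L : Logic S) (T : Set (Formula S)) : Formula S → Prop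
  | hyp (φ : Formula S) : φ ∈ T → Derives L T φ
  | rule (r : Rule S) (σ : ℕ → Formula S) : r ∈ L →
      (∀ ψ ∈ r.prem, Derives L T (ψ.subst σ)) → Derives L T (r.concl.subst σ)

open Formula in
/-- The axioms of MTL, instantiated with formulas of the language `S`. -/
inductive MTLAxiom {S : Signature.{u}} : Formula S → Prop
  | a1 (φ ψ χ : Formula S) : MTLAxiom (imp (imp φ ψ) (imp (imp ψ χ) (imp φ χ)))
  | a2 (φ ψ : Formula S) : MTLAxiom (imp (conj φ ψ) φ)
  | a3 (φ ψ : Formula S) : MTLAxiom (imp (conj φ ψ) (conj ψ φ))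
  | a4 (φ ψ : Formula S) : MTLAxiom (imp (and φ ψ) φ)
  | a5 (φ ψ : Formula S) : MTLAxiom (imp (and φ ψ) (and ψ φ))
  | a6 (φ ψ : Formula S) : MTLAxiom (imp (conj φ (imp φ ψ)) (and φ ψ))
  | a7a (φ ψ χ : Formula S) : MTLAxiom (imp (imp φ (imp ψ χ)) (imp (conj φ ψ) χ))
  | a7b (φ ψ χ : Formula S) : MTLAxiom (imp (imp (conj φ ψ) χ) (imp φ (imp ψ χ)))
  | a8 (φ ψ χ : Formula S) :
      MTLAxiom (imp (imp (imp φ ψ) χ) (imp (imp (imp ψ φ) χ) χ))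
  | a9 (φ : Formula S) : MTLAxiom (imp bot φ)

/-- `L` is a core expansion of MTL: a finitary expansion of MTL in which every additional
connective satisfies the congruence property (Cong) in each of its arguments. -/
structure IsCoreExpansion {S : Signature.{u}} (L : Logic S) : Prop where
  mtl : ∀ φ : Formula S, MTLAxiom φ → Derives L ∅ φ
  mp : ∀ φ ψ : Formula S, Derives L {φ, Formula.imp φ ψ} ψ
  cong : ∀ (c : S.Op) (χ : Fin (S.arity c) → Formula S) (i : Fin (S.arity c)) (φ ψ : Formula S),
    Derives L {Formula.imp φ ψ, Formula.imp ψ φ}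
      (Formula.imp (Formula.op c (Function.update χ i φ)) (Formula.op c (Function.update χ i ψ)))

/-- The structure of an MTL-algebra on a bounded lattice `A` (commutative bounded integral
residuated lattice satisfying prelinearity), together with an interpretation of the additional
connectives of `S`. The lattice operations and bounds `0`, `1` are those of `A`. -/
structure MTLAlgebra (S : Signature.{u}) (A : Type*) [Lattice A] [BoundedOrder A] where
  mul : A → A → A
  imp : A → A → A
  mul_assoc : ∀ x y z, mul (mul x y) z = mul x (mul y z)
  mul_comm : ∀ x y, mul x y = mul y x
  mul_top : ∀ x, mul x ⊤ = x
  residuation : ∀ x y z, mul x y ≤ z ↔ x ≤ imp y z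
  prelinear : ∀ x y, imp x y ⊔ imp y x = ⊤
  op : (c : S.Op) → (Fin (S.arity c) → A) → A

/-- The evaluation of formulas that extends an assignment `e` of values to the variables. -/
def MTLAlgebra.eval {S : Signature.{u}} {A : Type*} [Lattice A] [BoundedOrder A]
    (M : MTLAlgebra S A) (e : ℕ → A) : Formula S → A
  | .var n => e n
  | .bot => ⊥
  | .and φ ψ => M.eval e φ ⊓ M.eval e ψ
  | .conj φ ψ => M.mul (M.eval e φ) (M.eval e ψ)
  | .imp φ ψ => M.imp (M.eval e φ) (M.eval e ψ)
  | .op c a => M.op c (fun i => M.eval e (a i))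

/-- The evaluation `e` in `M` is a model of the set of formulas `T`. -/
def MTLAlgebra.IsModel {S : Signature.{u}} {A : Type*} [Lattice A] [BoundedOrder A]
    (M : MTLAlgebra S A) (e : ℕ → A) (T : Set (Formula S)) : Prop :=
  ∀ ψ ∈ T, M.eval e ψ = ⊤

/-- `M` is an `L`-algebra: every consequence of `L` preserves the value `1` in `M`. -/
def MTLAlgebra.IsAlgebraOf {S : Signature.{u}} {A : Type*} [Lattice A] [BoundedOrder A]
    (M : MTLAlgebra S A) (L : Logic S) : Prop :=
  ∀ (T : Set (Formula S)) (φ : Formula S), Derives L T φ →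
    ∀ e : ℕ → A, M.IsModel e T → M.eval e φ = ⊤

/-- `L` is semilinear: it is strongly complete with respect to the class of `L`-chains, i.e. of
linearly ordered `L`-algebras. (For countable languages it makes no difference in which universe
the chains live, as countable chains suffice.) -/
def Semilinear {S : Signature.{u}} (L : Logic S) : Prop :=
  ∀ (T : Set (Formula S)) (φ : Formula S), Derives L T φ ↔
    ∀ (A : Type u) [LinearOrder A] [BoundedOrder A] (M : MTLAlgebra S A), M.IsAlgebraOf L →
      ∀ e : ℕ → A, M.IsModel e T → M.eval e φ = ⊤

/-- `L` has the strong real completeness property: strong completeness with respect to the class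
of real `L`-chains, i.e. the `L`-algebras on the real unit interval with its usual order. -/
def StrongRealComplete {S : Signature.{u}} (L : Logic S) : Prop :=
  ∀ (T : Set (Formula S)) (φ : Formula S), Derives L T φ ↔
    ∀ M : MTLAlgebra S unitInterval, M.IsAlgebraOf L →
      ∀ e : ℕ → unitInterval, M.IsModel e T → M.eval e φ = ⊤

/-- The language `S` expanded with a new unary connective `∘` (the new symbol is `none`). -/
def Signature.withCirc (S : Signature.{u}) : Signature.{u} where
  Op := Option S.Op
  arity
    | none => 1
    | some c => S.arity c

namespace Formula

variable {S : Signature.{u}}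

/-- A formula of the language `S` viewed as a formula of the expanded language. -/
def lift : Formula S → Formula S.withCirc
  | var n => var n
  | bot => bot
  | and φ ψ => and φ.lift ψ.lift
  | conj φ ψ => conj φ.lift ψ.lift
  | imp φ ψ => imp φ.lift ψ.lift
  | op c a => op (S := S.withCirc) (some c) (fun i => (a i).lift)

/-- `∘φ` -/
def circ (φ : Formula S.withCirc) : Formula S.withCirc :=
  op (S := S.withCirc) none (fun _ => φ)

end Formula

/-- An axiom or rule of the language `S` viewed in the expanded language. -/
def Rule.lift {S : Signature.{u}} (r : Rule S) : Rule S.withCirc where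
  prem := r.prem.map Formula.lift
  concl := r.concl.lift

open Formula in
/-- The axioms and rules of `L_∘`: those of `L` (now schematic over the expanded language), the
axioms (A1), (A2), (A3) and the rules (Cong), (Coh). -/
inductive CircRule {S : Signature.{u}} (L : Logic S) : Rule S.withCirc → Prop
  | base (r : Rule S) : r ∈ L → CircRule L r.lift
  | a1 (φ : Formula S.withCirc) : CircRule L ⟨[], neg (and (and φ (neg φ)) (circ φ))⟩
  | a2 : CircRule L ⟨[], circ top⟩
  | a3 : CircRule L ⟨[], circ bot⟩
  | cong (φ ψ δ : Formula S.withCirc) :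
      CircRule L ⟨[or (iff φ ψ) δ], or (iff (circ φ) (circ ψ)) δ⟩
  | coh (φ ψ δ : Formula S.withCirc) :
      CircRule L ⟨[or (and (neg (neg φ)) (imp φ ψ)) δ], or (imp (circ φ) (circ ψ)) δ⟩

/-- The logic `L_∘`. -/
def Logic.withCirc {S : Signature.{u}} (L : Logic S) : Logic S.withCirc :=
  {r | CircRule L r}

/-! From `L_∘` to `L`: the reduct of a real `L_∘`-chain is a real `L`-chain, and every `L`-chain
expands to an `L_∘`-chain by letting `∘` be `1` at the two endpoints and `0` elsewhere. Hence `L_∘`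
is conservative over `L`, and completeness descends.

From `L` to `L_∘`: the side disjunct `δ` in (Cong) and (Coh), together with semilinearity of `L`,
gives proof by cases in `L_∘` (`Semilinear.or_elim`), so an underivable `φ` is omitted by a prime
theory `P`. Formulas of `L_∘` are countably many, so each can be named by a variable of `L`. Strong
real completeness of `L`, applied to the diagram of `P`, yields a valuation `h` in a real `L`-chain
that respects the connectives of `L` and has value `1` exactly on `P`
(`IsPrimeTheory.exists_real_valuation`). The operation `∘` is so far known only on the values of
`h`. (A1) and (A3) settle it at `0` and at points with nonzero negation. On the remaining points,
those with negation `0`, (Coh) makes it monotone, so suprema in `[0,1]` extend it to the whole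
interval. -/

namespace Formula

/-! ### Syntax: countability and substitution. -/

variable {S : Signature.{u}}

/-- The number of immediate subformulas below each formula constructor. -/
def nodeArity (S : Signature.{u}) : ℕ ⊕ Option (Fin 3) ⊕ S.Op → ℕ
  | .inl _ => 0
  | .inr (.inl none) => 0
  | .inr (.inl (some _)) => 2
  | .inr (.inr c) => S.arity c

/-- The syntax tree of a formula. -/
def toTree : Formula S → WType (fun a => Fin (nodeArity S a))
  | var n => ⟨.inl n, Fin.elim0⟩
  | bot => ⟨.inr (.inl none), Fin.elim0⟩
  | and φ ψ => ⟨.inr (.inl (some 0)), ![φ.toTree, ψ.toTree]⟩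
  | conj φ ψ => ⟨.inr (.inl (some 1)), ![φ.toTree, ψ.toTree]⟩
  | imp φ ψ => ⟨.inr (.inl (some 2)), ![φ.toTree, ψ.toTree]⟩
  | op c a => ⟨.inr (.inr c), fun i => (a i).toTree⟩

theorem vecCons_pair_injective {α : Type*} {a b c d : α} (h : ![a, b] = ![c, d]) :
    a = c ∧ b = d := ⟨congrFun h 0, congrFun h 1⟩

theorem toTree_injective : Function.Injective (toTree (S := S)) := by
  intro φ
  induction φ with
  | var n =>
    intro ψ h
    cases ψ <;> injection h with h <;> cases h
    rfl
  | bot =>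
    intro ψ h
    cases ψ <;> injection h with h <;> cases h
    rfl
  | and φ₁ φ₂ h₁ h₂ | conj φ₁ φ₂ h₁ h₂ | imp φ₁ φ₂ h₁ h₂ =>
    intro ψ h
    cases ψ <;> injection h with hl h <;> cases hl
    obtain ⟨ha, hb⟩ := vecCons_pair_injective h
    rw [h₁ ha, h₂ hb]
  | op c a ih =>
    intro ψ h
    cases ψ <;> injection h with hl h <;> cases hl
    congr 1
    funext i
    exact ih i (congrFun (eq_of_heq h) i)

/-- Allows the formulas of the expanded language to be named by propositional variables. -/
instance [Countable S.Op] : Countable (Formula S) := by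
  have : Encodable S.Op := Encodable.ofCountable _
  exact toTree_injective.countable

@[simp] theorem subst_var (φ : Formula S) : φ.subst var = φ := by
  induction φ <;> simp_all [subst]

theorem subst_subst (σ τ : ℕ → Formula S) (φ : Formula S) :
    (φ.subst σ).subst τ = φ.subst (fun n => (σ n).subst τ) := by
  induction φ <;> simp_all [subst]

theorem lift_subst (σ : ℕ → Formula S) (φ : Formula S) :
    (φ.subst σ).lift = φ.lift.subst (fun n => (σ n).lift) := by
  induction φ with
  | op c a ih => exact congrArg (op (S := S.withCirc) (some c)) (funext ih)
  | _ => simp_all [subst, lift]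

end Formula

/-! ### Derivations: cut, substitution, finitarity. -/

namespace Derives

variable {S : Signature.{u}} {L : Logic S} {T U : Set (Formula S)} {φ : Formula S}

theorem cut (h : Derives L T φ) (hT : ∀ ψ ∈ T, Derives L U ψ) : Derives L U φ := by
  induction h with
  | hyp ψ hψ => exact hT ψ hψ
  | rule r σ hr _ ih => exact .rule r σ hr ih

theorem mono (h : Derives L T φ) (hT : T ⊆ U) : Derives L U φ :=
  h.cut fun ψ hψ => .hyp ψ (hT hψ)

theorem subst (h : Derives L T φ) (σ : ℕ → Formula S) :
    Derives L (Formula.subst σ '' T) (φ.subst σ) := by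
  induction h with
  | hyp ψ hψ => exact .hyp _ ⟨ψ, hψ, rfl⟩
  | rule r τ hr _ ih =>
    rw [Formula.subst_subst]
    refine .rule r _ hr fun ψ hψ => ?_
    rw [← Formula.subst_subst]
    exact ih ψ hψ

theorem lift (h : Derives L T φ) : Derives L.withCirc (Formula.lift '' T) φ.lift := by
  induction h with
  | hyp ψ hψ => exact .hyp _ ⟨ψ, hψ, rfl⟩
  | rule r τ hr _ ih =>
    rw [Formula.lift_subst]
    refine .rule r.lift _ (CircRule.base r hr) fun ψ hψ => ?_
    obtain ⟨χ, hχ, rfl⟩ := List.mem_map.1 hψ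
    rw [← Formula.lift_subst]
    exact ih χ hχ

theorem exists_finite (h : Derives L T φ) : ∃ F ⊆ T, F.Finite ∧ Derives L F φ := by
  induction h with
  | hyp ψ hψ => exact ⟨{ψ}, by simpa using hψ, Set.finite_singleton _, .hyp _ rfl⟩
  | rule r σ hr _ ih =>
    choose F hF using ih
    have : Finite {ψ // ψ ∈ r.prem} := r.prem.finite_toSet
    refine ⟨⋃ ψ : {ψ // ψ ∈ r.prem}, F ψ.1 ψ.2, Set.iUnion_subset fun ψ => (hF _ ψ.2).1,
      Set.finite_iUnion fun ψ => (hF _ ψ.2).2.1, .rule r σ hr fun ψ hψ => ?_⟩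
    exact (hF ψ hψ).2.2.mono (Set.subset_iUnion (fun ψ : {ψ // ψ ∈ r.prem} => F ψ.1 ψ.2) ⟨ψ, hψ⟩)

theorem of_rule {r : Rule S} (hr : r ∈ L) (h : ∀ ψ ∈ r.prem, Derives L T ψ) :
    Derives L T r.concl := by
  have := Derives.rule (T := T) r Formula.var hr (by simpa using h)
  simpa using this

/-- A derivation in `L` can be instantiated in `L.withCirc`. -/
theorem lift_subst {T : Set (Formula S.withCirc)} {Γ : Set (Formula S)} (h : Derives L Γ φ)
    (σ : ℕ → Formula S.withCirc) (hΓ : ∀ ψ ∈ Γ, Derives L.withCirc T (ψ.lift.subst σ)) :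
    Derives L.withCirc T (φ.lift.subst σ) := by
  refine (h.lift.subst σ).cut ?_
  rintro _ ⟨_, ⟨ψ, hψ, rfl⟩, rfl⟩
  exact hΓ ψ hψ

end Derives

/-! ### MTL-algebras, reducts and expansions by `∘`. -/

namespace MTLAlgebra

variable {S : Signature.{u}}

section Lattice

variable {A : Type*} [Lattice A] [BoundedOrder A] (M : MTLAlgebra S A)

theorem imp_eq_top {x y : A} : M.imp x y = ⊤ ↔ x ≤ y := by
  rw [eq_top_iff, ← M.residuation, M.mul_comm, M.mul_top]

theorem le_imp_imp (x y : A) : x ≤ M.imp (M.imp x y) y := by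
  rw [← M.residuation, M.mul_comm, M.residuation]

theorem top_imp (x : A) : M.imp ⊤ x = x := by
  refine le_antisymm ?_ ?_
  · have := (M.residuation (M.imp ⊤ x) ⊤ x).2 le_rfl
    rwa [M.mul_top] at this
  · rw [← M.residuation, M.mul_top]

theorem mul_le_mul_left {x y : A} (h : x ≤ y) (z : A) : M.mul z x ≤ M.mul z y := by
  rw [M.mul_comm z x, M.mul_comm z y, M.residuation]
  exact h.trans ((M.residuation _ _ _).1 le_rfl)

theorem eval_subst (e : ℕ → A) (σ : ℕ → Formula S) (φ : Formula S) :
    M.eval e (φ.subst σ) = M.eval (fun n => M.eval e (σ n)) φ := by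
  induction φ <;> simp_all [eval, Formula.subst]

theorem eval_top (e : ℕ → A) : M.eval e Formula.top = ⊤ := by
  simp [Formula.top, Formula.neg, eval, imp_eq_top]

theorem eval_iff_eq_top {e : ℕ → A} {φ ψ : Formula S} :
    M.eval e (φ.iff ψ) = ⊤ ↔ M.eval e φ = M.eval e ψ := by
  simp only [Formula.iff, eval, inf_eq_top_iff, imp_eq_top]
  exact le_antisymm_iff.symm

/-- The reduct of an algebra to the language without `∘`. -/
def reduct (M : MTLAlgebra S.withCirc A) : MTLAlgebra S A where
  mul := M.mul
  imp := M.imp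
  mul_assoc := M.mul_assoc
  mul_comm := M.mul_comm
  mul_top := M.mul_top
  residuation := M.residuation
  prelinear := M.prelinear
  op c := M.op (some c)

theorem eval_reduct (M : MTLAlgebra S.withCirc A) (e : ℕ → A) (φ : Formula S) :
    M.reduct.eval e φ = M.eval e φ.lift := by
  induction φ with
  | op c a ih => simp only [eval, Formula.lift, ih]; rfl
  | _ => simp_all [eval, Formula.lift, reduct]

theorem IsAlgebraOf.reduct {M : MTLAlgebra S.withCirc A} {L : Logic S}
    (h : M.IsAlgebraOf L.withCirc) : M.reduct.IsAlgebraOf L := by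
  intro T φ hφ e he
  rw [eval_reduct]
  refine h _ _ hφ.lift e ?_
  rintro _ ⟨ψ, hψ, rfl⟩
  rw [← eval_reduct]
  exact he ψ hψ

/-- The expansion of an algebra by an interpretation of `∘`. -/
def expand (f : A → A) : MTLAlgebra S.withCirc A where
  mul := M.mul
  imp := M.imp
  mul_assoc := M.mul_assoc
  mul_comm := M.mul_comm
  mul_top := M.mul_top
  residuation := M.residuation
  prelinear := M.prelinear
  op
    | none => fun a => f (a (0 : Fin 1))
    | some c => M.op c

theorem reduct_expand (f : A → A) : (M.expand f).reduct = M := rfl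

theorem eval_expand_lift (f : A → A) (e : ℕ → A) (φ : Formula S) :
    (M.expand f).eval e φ.lift = M.eval e φ := by
  rw [← eval_reduct, reduct_expand]

theorem eval_expand_circ (f : A → A) (e : ℕ → A) (φ : Formula S.withCirc) :
    (M.expand f).eval e φ.circ = f ((M.expand f).eval e φ) := rfl

end Lattice

/-! ### Expanding chains to models of `L_∘`. -/

section Chain

variable {A : Type*} [LinearOrder A] [BoundedOrder A] (M : MTLAlgebra S A)

theorem eval_or (e : ℕ → A) (φ ψ : Formula S) :
    M.eval e (φ.or ψ) = M.eval e φ ⊔ M.eval e ψ := by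
  simp only [Formula.or, eval]
  rcases le_total (M.eval e φ) (M.eval e ψ) with h | h
  · rw [M.imp_eq_top.2 h, M.top_imp, sup_eq_right.2 h, inf_eq_left]
    exact M.le_imp_imp _ _
  · rw [M.imp_eq_top.2 h, M.top_imp, sup_eq_left.2 h, inf_eq_right]
    exact M.le_imp_imp _ _

theorem eval_or_eq_top {e : ℕ → A} {φ ψ : Formula S} :
    M.eval e (φ.or ψ) = ⊤ ↔ M.eval e φ = ⊤ ∨ M.eval e ψ = ⊤ := by
  rw [eval_or]
  exact max_eq_top

/-- The conditions on the interpretation of `∘` under which an `L`-chain expands to an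
`L.withCirc`-chain. -/
structure IsConsistencyOp (f : A → A) : Prop where
  inf_eq_bot : ∀ x, x ⊓ M.imp x ⊥ ⊓ f x = ⊥
  map_top : f ⊤ = ⊤
  map_bot : f ⊥ = ⊤
  mono : ∀ x y, M.imp x ⊥ = ⊥ → x ≤ y → f x ≤ f y

variable {M}

/-- In a chain a disjunction has value `1` only if a disjunct does, so the side disjunct of (Cong)
and (Coh) is harmless and each condition on `f` validates its own axiom or rule. -/
theorem IsConsistencyOp.isAlgebraOf {L : Logic S} {f : A → A} (hf : M.IsConsistencyOp f)
    (hM : M.IsAlgebraOf L) : (M.expand f).IsAlgebraOf L.withCirc := by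
  intro T φ h e he
  induction h with
  | hyp ψ hψ => exact he ψ hψ
  | rule r σ hr _ ih =>
    rw [eval_subst]
    simp only [eval_subst] at ih
    -- The substitution is absorbed into the assignment, leaving the uninstantiated rule.
    generalize (fun n => (M.expand f).eval e (σ n)) = e' at ih ⊢
    cases hr with
    | base r hr =>
      change (M.expand f).eval e' r.concl.lift = ⊤
      rw [eval_expand_lift]
      refine hM {ψ | ψ ∈ r.prem} _ (.of_rule hr fun ψ hψ => .hyp ψ hψ) e' fun ψ hψ => ?_
      rw [← eval_expand_lift]
      exact ih _ (List.mem_map_of_mem hψ)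
    | a1 φ =>
      exact (M.expand f).imp_eq_top.2 (hf.inf_eq_bot ((M.expand f).eval e' φ)).le
    | a2 => rw [eval_expand_circ, eval_top, hf.map_top]
    | a3 => exact hf.map_bot
    | cong φ ψ δ =>
      have := ih _ (List.mem_singleton_self _)
      rw [eval_or_eq_top, eval_iff_eq_top] at this ⊢
      exact this.imp_left fun h => by rw [eval_expand_circ, eval_expand_circ, h]
    | coh φ ψ δ =>
      have := ih _ (List.mem_singleton_self _)
      rw [eval_or_eq_top] at this ⊢
      refine this.imp_left fun h => (M.expand f).imp_eq_top.2 ?_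
      rw [eval_expand_circ, eval_expand_circ]
      obtain ⟨h₁, h₂⟩ := inf_eq_top_iff.1 h
      exact hf.mono _ _ (le_bot_iff.1 ((M.expand f).imp_eq_top.1 h₁))
        ((M.expand f).imp_eq_top.1 h₂)

/-- Every `L`-chain expands to an `L.withCirc`-chain in which `∘` is the classicality operator. -/
theorem exists_isConsistencyOp (M : MTLAlgebra S A) : ∃ f : A → A, M.IsConsistencyOp f := by
  classical
  refine ⟨fun x => if x = ⊥ ∨ x = ⊤ then ⊤ else ⊥, fun x => ?_, by simp, by simp,
    fun x y hx hxy => ?_⟩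
  · by_cases h : x = ⊥
    · simp [h]
    by_cases h' : x = ⊤
    · simp [h', M.top_imp]
    · simp [h, h']
  · by_cases h : x = ⊥
    · subst h
      -- A bottom element with negation `⊥` forces the chain to be trivial.
      have : (⊤ : A) = ⊥ := by rw [← hx, M.imp_eq_top.2 le_rfl]
      exact le_of_le_of_eq le_top (by rw [this]; exact (le_bot_iff.1 (this ▸ le_top)).symm)
    by_cases h' : x = ⊤
    · have : y = ⊤ := top_le_iff.1 (h' ▸ hxy)
      simp [this]
    · simp [h, h']

end Chain

end MTLAlgebra

/-- Strong real completeness of `L.withCirc` transfers to `L` by conservativity. -/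
theorem StrongRealComplete.of_withCirc {S : Signature.{u}} {L : Logic S} (hsemi : Semilinear L)
    (h : StrongRealComplete L.withCirc) : StrongRealComplete L := by
  refine fun T φ => ⟨fun hφ M hM => hM T φ hφ, fun hφ => (hsemi T φ).2 fun A _ _ M hM e he => ?_⟩
  have hder : Derives L.withCirc (Formula.lift '' T) φ.lift := by
    refine (h _ _).2 fun N hN e he => ?_
    rw [← MTLAlgebra.eval_reduct]
    refine hφ N.reduct hN.reduct e fun ψ hψ => ?_
    rw [MTLAlgebra.eval_reduct]
    exact he _ ⟨ψ, hψ, rfl⟩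
  obtain ⟨f, hf⟩ := M.exists_isConsistencyOp
  rw [← M.eval_expand_lift f]
  refine hf.isAlgebraOf hM _ _ hder e ?_
  rintro _ ⟨ψ, hψ, rfl⟩
  rw [M.eval_expand_lift f]
  exact he ψ hψ

open Formula MTLAlgebra

/-! ### Proof by cases in `L_∘`. -/

section ProofByCases

variable {S : Signature.{u}} {L : Logic S} {T : Set (Formula S.withCirc)}
  {α β γ φ ψ : Formula S.withCirc}

/-- Inferences that are sound in all MTL-chains are derivable. -/
theorem Semilinear.derives_withCirc (hsemi : Semilinear L) (Γ : Set (Formula S)) (χ : Formula S)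
    (hsound : ∀ (A : Type u) [LinearOrder A] [BoundedOrder A] (M : MTLAlgebra S A) (e : ℕ → A),
      M.IsModel e Γ → M.eval e χ = ⊤)
    (σ : ℕ → Formula S.withCirc) (hΓ : ∀ ψ ∈ Γ, Derives L.withCirc T (ψ.lift.subst σ)) :
    Derives L.withCirc T (χ.lift.subst σ) :=
  ((hsemi Γ χ).2 fun A _ _ M _ e he => hsound A M e he).lift_subst σ hΓ

theorem Semilinear.or_inl (hsemi : Semilinear L) (h : Derives L.withCirc T α) :
    Derives L.withCirc T (α.or β) :=
  hsemi.derives_withCirc {var 0} (Formula.or (var 0) (var 1))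
    (fun A _ _ M e he => M.eval_or_eq_top.2 (.inl (he _ rfl)))
    (fun n => if n = 0 then α else β) (by rintro _ rfl; exact h)

theorem Semilinear.or_comm (hsemi : Semilinear L) (h : Derives L.withCirc T (α.or β)) :
    Derives L.withCirc T (β.or α) :=
  hsemi.derives_withCirc {Formula.or (var 0) (var 1)} (Formula.or (var 1) (var 0))
    (fun A _ _ M e he => M.eval_or_eq_top.2 (M.eval_or_eq_top.1 (he _ rfl)).symm)
    (fun n => if n = 0 then α else β) (by rintro _ rfl; exact h)

theorem Semilinear.or_self (hsemi : Semilinear L) (h : Derives L.withCirc T (α.or α)) :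
    Derives L.withCirc T α :=
  hsemi.derives_withCirc {Formula.or (var 0) (var 0)} (var 0)
    (fun A _ _ M e he => (or_self_iff).1 (M.eval_or_eq_top.1 (he _ rfl)))
    (fun _ => α) (by rintro _ rfl; exact h)

theorem Semilinear.or_assoc (hsemi : Semilinear L)
    (h : Derives L.withCirc T ((α.or β).or γ)) : Derives L.withCirc T (α.or (β.or γ)) :=
  hsemi.derives_withCirc {Formula.or (Formula.or (var 0) (var 1)) (var 2)}
    (Formula.or (var 0) (Formula.or (var 1) (var 2)))
    (fun A _ _ M e he => by
      have := he _ rfl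
      simp only [eval_or_eq_top] at this ⊢
      tauto)
    (fun n => if n = 0 then α else if n = 1 then β else γ) (by rintro _ rfl; exact h)

theorem Semilinear.or_assoc' (hsemi : Semilinear L)
    (h : Derives L.withCirc T (α.or (β.or γ))) : Derives L.withCirc T ((α.or β).or γ) :=
  hsemi.derives_withCirc {Formula.or (var 0) (Formula.or (var 1) (var 2))}
    (Formula.or (Formula.or (var 0) (var 1)) (var 2))
    (fun A _ _ M e he => by
      have := he _ rfl
      simp only [eval_or_eq_top] at this ⊢
      tauto)
    (fun n => if n = 0 then α else if n = 1 then β else γ) (by rintro _ rfl; exact h)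

theorem Semilinear.imp_refl (hsemi : Semilinear L) (T : Set (Formula S.withCirc))
    (α : Formula S.withCirc) : Derives L.withCirc T (imp α α) :=
  hsemi.derives_withCirc ∅ (imp (var 0) (var 0))
    (fun A _ _ M e _ => M.imp_eq_top.2 le_rfl) (fun _ => α) (by simp)

theorem Semilinear.imp_or_left (hsemi : Semilinear L) (T : Set (Formula S.withCirc))
    (α β : Formula S.withCirc) : Derives L.withCirc T (imp α (α.or β)) :=
  hsemi.derives_withCirc ∅ (imp (var 0) (Formula.or (var 0) (var 1)))
    (fun A _ _ M e _ => M.imp_eq_top.2 (by rw [eval_or]; exact le_sup_left))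
    (fun n => if n = 0 then α else β) (by simp)

theorem Semilinear.imp_or_right (hsemi : Semilinear L) (h : Derives L.withCirc T (imp α β))
    (γ : Formula S.withCirc) : Derives L.withCirc T (imp α (γ.or β)) :=
  hsemi.derives_withCirc {imp (var 0) (var 1)} (imp (var 0) (Formula.or (var 2) (var 1)))
    (fun A _ _ M e he => M.imp_eq_top.2 (by
      rw [eval_or]; exact le_sup_of_le_right (M.imp_eq_top.1 (he _ rfl))))
    (fun n => if n = 0 then α else if n = 1 then β else γ) (by rintro _ rfl; exact h)

/-- The rules of a semilinear logic remain derivable when a side disjunct is added. -/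
theorem Semilinear.rule_or (hsemi : Semilinear L) {r : Rule S} (hr : r ∈ L)
    (σ : ℕ → Formula S.withCirc) (δ : Formula S.withCirc)
    (h : ∀ ψ ∈ r.prem, Derives L.withCirc T ((ψ.lift.subst σ).or δ)) :
    Derives L.withCirc T ((r.concl.lift.subst σ).or δ) := by
  -- Shifting the variables frees `var 0` to stand for `δ`. The rule with side disjunct then lives
  -- in the language of `L`, where it can be checked on `L`-chains.
  have key : ∀ ψ : Formula S, ((ψ.subst fun n => var (n + 1)).or (var 0)).lift.subst
      (fun n => n.casesOn δ σ) = (ψ.lift.subst σ).or δ := by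
    intro ψ
    have : (ψ.subst fun n => var (n + 1)).lift.subst (fun n => n.casesOn δ σ)
        = ψ.lift.subst σ := by
      rw [Formula.lift_subst, Formula.subst_subst]; rfl
    rw [← this]; rfl
  rw [← key]
  refine Derives.lift_subst (Γ := {χ | ∃ ψ ∈ r.prem,
    χ = (ψ.subst fun n => var (n + 1)).or (var 0)}) ((hsemi _ _).2 ?_) _ ?_
  · intro A _ _ M hM e he
    rw [eval_or_eq_top]
    by_cases hδ : M.eval e (var 0) = ⊤
    · exact .inr hδ
    refine .inl ?_
    rw [eval_subst]
    refine hM {ψ | ψ ∈ r.prem} _ (.of_rule hr fun ψ hψ => .hyp ψ hψ) _ fun ψ hψ => ?_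
    rw [← eval_subst]
    exact (M.eval_or_eq_top.1 (he _ ⟨ψ, hψ, rfl⟩)).resolve_right hδ
  · rintro _ ⟨ψ, hψ, rfl⟩
    rw [key]
    exact h ψ hψ

theorem Semilinear.derives_or (hsemi : Semilinear L) {U : Set (Formula S.withCirc)}
    (h : Derives L.withCirc T φ) (δ : Formula S.withCirc)
    (hU : ∀ ψ ∈ T, Derives L.withCirc U (ψ.or δ)) : Derives L.withCirc U (φ.or δ) := by
  induction h with
  | hyp ψ hψ => exact hU ψ hψ
  | rule r σ hr hprem ih =>
    cases hr with
    | base r hr =>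
      exact hsemi.rule_or hr σ δ fun ψ hψ => ih _ (List.mem_map_of_mem hψ)
    | a1 φ => exact hsemi.or_inl (.rule _ σ (CircRule.a1 φ) (by simp))
    | a2 => exact hsemi.or_inl (.rule _ σ CircRule.a2 (by simp))
    | a3 => exact hsemi.or_inl (.rule _ σ CircRule.a3 (by simp))
    | cong φ ψ χ =>
      refine hsemi.or_assoc' (Derives.of_rule
        (CircRule.cong (φ.subst σ) (ψ.subst σ) ((χ.subst σ).or δ)) fun θ hθ => ?_)
      rw [List.mem_singleton.1 hθ]
      exact hsemi.or_assoc (ih _ (List.mem_singleton_self _))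
    | coh φ ψ χ =>
      refine hsemi.or_assoc' (Derives.of_rule
        (CircRule.coh (φ.subst σ) (ψ.subst σ) ((χ.subst σ).or δ)) fun θ hθ => ?_)
      rw [List.mem_singleton.1 hθ]
      exact hsemi.or_assoc (ih _ (List.mem_singleton_self _))

/-- Replace the disjuncts one at a time: `α ∨ β` yields `φ ∨ β`, which yields `φ ∨ φ`. -/
theorem Semilinear.or_elim (hsemi : Semilinear L) (h : Derives L.withCirc T (α.or β))
    (hα : Derives L.withCirc (insert α T) φ) (hβ : Derives L.withCirc (insert β T) φ) :
    Derives L.withCirc T φ := by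
  have h₁ : Derives L.withCirc T (φ.or β) := by
    refine hsemi.derives_or hα β fun ψ hψ => ?_
    rcases hψ with rfl | hψ
    · exact h
    · exact hsemi.or_inl (.hyp ψ hψ)
  refine hsemi.or_self (hsemi.derives_or hβ φ fun ψ hψ => ?_)
  rcases hψ with rfl | hψ
  · exact hsemi.or_comm h₁
  · exact hsemi.or_inl (.hyp ψ hψ)

end ProofByCases

/-! ### Prime theories. -/

/-- A deductively closed set of formulas with the disjunction property. -/
structure IsPrimeTheory {S : Signature.{u}} (L : Logic S) (P : Set (Formula S)) : Prop where
  mem_of_derives : ∀ ψ, Derives L P ψ → ψ ∈ P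
  prime : ∀ α β, α.or β ∈ P → α ∈ P ∨ β ∈ P

/-- Every underivable formula is omitted by a prime theory. -/
theorem Semilinear.exists_isPrimeTheory {S : Signature.{u}} {L : Logic S} (hsemi : Semilinear L)
    {T : Set (Formula S.withCirc)} {φ : Formula S.withCirc} (h : ¬ Derives L.withCirc T φ) :
    ∃ P, T ⊆ P ∧ φ ∉ P ∧ IsPrimeTheory L.withCirc P := by
  -- `P` is maximal among the sets not deriving `φ`; finitarity handles unions of chains.
  obtain ⟨P, hTP, hP⟩ := zorn_subset_nonempty {P | ¬ Derives L.withCirc P φ} (by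
    intro C hC hchain hne
    refine ⟨⋃₀ C, fun hder => ?_, fun s hs => Set.subset_sUnion_of_mem hs⟩
    obtain ⟨F, hF, hfin, hder⟩ := hder.exists_finite
    obtain ⟨s, hs, hFs⟩ := DirectedOn.exists_mem_subset_of_finite_of_subset_sUnion hne
      hchain.directedOn hfin hF
    exact hC hs (hder.mono hFs)) T h
  have hder : ¬ Derives L.withCirc P φ := hP.prop
  have hins : ∀ ψ, ψ ∉ P → Derives L.withCirc (insert ψ P) φ := by
    intro ψ hψ
    by_contra hnot
    exact hψ (hP.le_of_ge (y := insert ψ P) hnot (Set.subset_insert _ _) (Set.mem_insert _ _))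
  refine ⟨P, hTP, fun hφ => hder (.hyp φ hφ), fun ψ hψ => ?_, fun α β hαβ => ?_⟩
  · by_contra hnot
    refine hder ((hins ψ hnot).cut ?_)
    rintro χ (rfl | hχ)
    · exact hψ
    · exact .hyp χ hχ
  · by_contra! hnot
    exact hder (hsemi.or_elim (.hyp _ hαβ) (hins α hnot.1) (hins β hnot.2))

/-! ### Realizing a prime theory in a real `L`-chain. -/

section Embedding

variable {S : Signature.{u}} {L : Logic S} {P : Set (Formula S.withCirc)}

/-- Finitely many formulas outside a prime theory have a common upper bound outside it. -/
theorem IsPrimeTheory.exists_upper_bound (hP : IsPrimeTheory L.withCirc P) (hsemi : Semilinear L)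
    {φ : Formula S.withCirc} (hφ : φ ∉ P) {F : Set (Formula S.withCirc)} (hF : F.Finite)
    (hFP : ∀ γ ∈ F, γ ∉ P) : ∃ δ ∉ P, ∀ γ ∈ F, imp γ δ ∈ P := by
  induction F, hF using Set.Finite.induction_on with
  | empty => exact ⟨φ, hφ, by simp⟩
  | @insert γ F _ _ ih =>
    obtain ⟨δ, hδ, hle⟩ := ih fun χ hχ => hFP χ (Set.mem_insert_of_mem _ hχ)
    refine ⟨γ.or δ, fun h => ?_, ?_⟩
    · exact (hP.prime _ _ h).elim (hFP γ (Set.mem_insert _ _)) hδ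
    · rintro χ (rfl | hχ)
      · exact hP.mem_of_derives _ (hsemi.imp_or_left _ _ _)
      · exact hP.mem_of_derives _ (hsemi.imp_or_right (.hyp _ (hle χ hχ)) γ)

/-- If `L` is strongly real complete, then a prime theory of `L.withCirc` is the set of
designated formulas of a valuation in a real `L`-chain that respects the connectives of `L`. -/
theorem IsPrimeTheory.exists_real_valuation [Countable S.Op] (hP : IsPrimeTheory L.withCirc P)
    (hsemi : Semilinear L) (hreal : StrongRealComplete L)
    {φ : Formula S.withCirc} (hφ : φ ∉ P) :
    ∃ M : MTLAlgebra S unitInterval, M.IsAlgebraOf L ∧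
      ∃ h : Formula S.withCirc → unitInterval,
        (∀ ψ, h ψ = ⊤ ↔ ψ ∈ P) ∧
        h bot = ⊥ ∧ (∀ α β, h (and α β) = h α ⊓ h β) ∧ (∀ α β, h (conj α β) = M.mul (h α) (h β)) ∧
        (∀ α β, h (imp α β) = M.imp (h α) (h β)) ∧
        ∀ (c : S.Op) (a : Fin (S.arity c) → Formula S.withCirc),
          h (op (S := S.withCirc) (some c) a) = M.op c fun i => h (a i) := by
  have : Countable S.withCirc.Op := inferInstanceAs (Countable (Option S.Op))
  have : Nonempty (Formula S.withCirc) := ⟨bot⟩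
  obtain ⟨g, hg⟩ := exists_surjective_nat (Formula S.withCirc)
  choose code hcode using hg
  let sh : Formula S → Formula S := Formula.subst fun n => var (n + 1)
  -- The variable `n + 1` names the formula `g n`. The fresh `var 0` is to bound from above
  -- everything outside `P`, so that a model giving it a value below `1` designates exactly `P`.
  let T : Set (Formula S) := {θ | ∃ χ : Formula S, χ.lift.subst g ∈ P ∧ θ = sh χ} ∪
    {θ | ∃ χ : Formula S, χ.lift.subst g ∉ P ∧ θ = imp (sh χ) (var 0)}
  have hsh : ∀ (χ : Formula S) (δ : Formula S.withCirc),
      (sh χ).lift.subst (fun n => n.casesOn δ g) = χ.lift.subst g := by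
    intro χ δ
    rw [Formula.lift_subst, Formula.subst_subst]; rfl
  -- A derivation uses finitely many bounds on `var 0`; interpreting `var 0` as a common upper bound
  -- `δ ∉ P` would put `δ` in `P`.
  have hT : ¬ Derives L T (var 0) := by
    intro hder
    obtain ⟨F, hFT, hfin, hder⟩ := hder.exists_finite
    have hfin' : {γ | γ ∉ P ∧ ∃ χ : Formula S, χ.lift.subst g = γ ∧
        imp (sh χ) (var 0) ∈ F}.Finite := by
      -- The match recovers the excluded formula from the hypothesis bounding it by `var 0`; its
      -- values on other formulas are irrelevant.
      refine (hfin.image fun θ => match θ with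
        | .imp α _ => α.lift.subst (fun n => n.casesOn bot g)
        | _ => bot).subset ?_
      rintro _ ⟨_, χ, rfl, hχ⟩
      exact ⟨_, hχ, hsh χ bot⟩
    obtain ⟨δ, hδ, hle⟩ := hP.exists_upper_bound hsemi hφ hfin' fun γ hγ => hγ.1
    refine hδ (hP.mem_of_derives _ (hder.lift_subst (fun n => n.casesOn δ g) fun θ hθ => .hyp _ ?_))
    rcases hFT hθ with ⟨χ, hχ, rfl⟩ | ⟨χ, hχ, rfl⟩
    · rwa [hsh]
    · have := hle _ ⟨hχ, χ, rfl, hθ⟩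
      rw [← hsh χ δ] at this
      exact this
  rw [hreal] at hT
  push Not at hT
  obtain ⟨M, hM, e, he, h0⟩ := hT
  have hiff : ∀ χ : Formula S, M.eval (fun n => e (n + 1)) χ = ⊤ ↔ χ.lift.subst g ∈ P := by
    intro χ
    have hev : M.eval e (sh χ) = M.eval (fun n => e (n + 1)) χ := M.eval_subst _ _ _
    rw [← hev]
    refine ⟨fun h => ?_, fun h => he _ (.inl ⟨χ, h, rfl⟩)⟩
    by_contra hnot
    have := M.imp_eq_top.1 (he _ (.inr ⟨χ, hnot, rfl⟩))
    exact h0 (top_le_iff.1 (h ▸ this))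
  -- Both implications between a compound and the variable naming it translate to `ψ → ψ`, which is
  -- in `P`. This makes the valuation respect the connectives of `L`.
  have hvar : ∀ (ψ : Formula S.withCirc) (χ : Formula S), χ.lift.subst g = ψ →
      e (code ψ + 1) = M.eval (fun n => e (n + 1)) χ := by
    rintro ψ χ rfl
    have hrefl := hP.mem_of_derives _ (hsemi.imp_refl P (χ.lift.subst g))
    refine le_antisymm (M.imp_eq_top.1 ((hiff (imp (var (code (χ.lift.subst g))) χ)).2 ?_))
      (M.imp_eq_top.1 ((hiff (imp χ (var (code (χ.lift.subst g))))).2 ?_)) <;>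
    simpa only [Formula.lift, Formula.subst, hcode] using hrefl
  refine ⟨M, hM, fun ψ => e (code ψ + 1), fun ψ => ?_, hvar _ bot rfl, fun α β => ?_,
    fun α β => ?_, fun α β => ?_, fun c a => ?_⟩
  · have := hiff (var (code ψ))
    rwa [Formula.lift, Formula.subst, hcode] at this
  · exact hvar _ (and (var (code α)) (var (code β))) (by simp [Formula.lift, Formula.subst, hcode])
  · exact hvar _ (conj (var (code α)) (var (code β)))
      (by simp [Formula.lift, Formula.subst, hcode])
  · exact hvar _ (imp (var (code α)) (var (code β))) (by simp [Formula.lift, Formula.subst, hcode])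
  · exact hvar _ (op c fun i => var (code (a i))) (by simp [Formula.lift, Formula.subst, hcode])

end Embedding

/-! ### Extending `∘` to the real interval and conclusion. -/

/-- Strong real completeness of `L` transfers to `L.withCirc`. -/
theorem StrongRealComplete.withCirc {S : Signature.{u}} [Countable S.Op] {L : Logic S}
    (hsemi : Semilinear L) (hreal : StrongRealComplete L) : StrongRealComplete L.withCirc := by
  classical
  refine fun T φ => ⟨fun hφ M hM => hM T φ hφ, fun hφ => ?_⟩
  by_contra hder
  obtain ⟨P, hTP, hφP, hP⟩ := hsemi.exists_isPrimeTheory hder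
  obtain ⟨M, hM, h, htop, hbot, hand, hconj, himp, hop⟩ :=
    hP.exists_real_valuation hsemi hreal hφP
  have hmem : ∀ {r : Rule S.withCirc}, CircRule L r → (∀ ψ ∈ r.prem, ψ ∈ P) → r.concl ∈ P :=
    fun hr hprem => hP.mem_of_derives _ (.of_rule hr fun ψ hψ => .hyp ψ (hprem ψ hψ))
  have hle : ∀ α β, h α ≤ h β ↔ imp α β ∈ P := by
    intro α β
    rw [← htop, himp, M.imp_eq_top]
  have hneg : ∀ α, h (neg α) = M.imp (h α) ⊥ := fun α => by rw [neg, himp, hbot]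
  have hmem_or : ∀ {α β : Formula S.withCirc}, α ∈ P → α.or β ∈ P :=
    fun hα => hP.mem_of_derives _ (hsemi.or_inl (.hyp _ hα))
  have hcirc_top : h (circ Formula.top) = ⊤ := (htop _).2 (hmem CircRule.a2 (by simp))
  have hcirc_bot : h (circ bot) = ⊤ := (htop _).2 (hmem CircRule.a3 (by simp))
  have hformula_top : h Formula.top = ⊤ := by
    rw [Formula.top, hneg, hbot, M.imp_eq_top]
  have hA1 : ∀ α, h α ⊓ M.imp (h α) ⊥ ⊓ h (circ α) = ⊥ := by
    intro α
    have := (hle _ _).2 (hmem (CircRule.a1 α) (by simp))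
    rwa [hbot, hand, hand, hneg, le_bot_iff] at this
  have hcong : ∀ α β, h α = h β → h (circ α) = h (circ β) := by
    intro α β hαβ
    have hi : Formula.iff α β ∈ P := by
      rw [← htop, Formula.iff, hand, (htop _).2 ((hle _ _).1 hαβ.le),
        (htop _).2 ((hle _ _).1 hαβ.ge), inf_idem]
    -- With the conclusion itself as side disjunct, primeness returns that conclusion in either
    -- case. The same device serves (Coh).
    have := hmem (CircRule.cong α β (Formula.iff (circ α) (circ β))) (by
      rintro _ hψ; rw [List.mem_singleton.1 hψ]; exact hmem_or hi)
    have := (or_self_iff).1 (hP.prime _ _ this)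
    rw [← htop, Formula.iff, hand, inf_eq_top_iff, htop, htop, ← hle, ← hle] at this
    exact le_antisymm this.1 this.2
  have hcoh : ∀ α β, M.imp (h α) ⊥ = ⊥ → h α ≤ h β → h (circ α) ≤ h (circ β) := by
    intro α β hα hαβ
    have hi : and (neg (neg α)) (imp α β) ∈ P := by
      rw [← htop, hand, hneg, hneg, hα, M.imp_eq_top.2 le_rfl, (htop _).2 ((hle _ _).1 hαβ),
        inf_idem]
    have := hmem (CircRule.coh α β (imp (circ α) (circ β))) (by
      rintro _ hψ; rw [List.mem_singleton.1 hψ]; exact hmem_or hi)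
    exact (hle _ _).2 ((or_self_iff).1 (hP.prime _ _ this))
  have hne : (⊤ : unitInterval) ≠ ⊥ := top_ne_bot
  have hnbot : M.imp ⊥ ⊥ = ⊤ := M.imp_eq_top.2 le_rfl
  -- The first and last values are forced by (A3) and (A1). In between, `f` is the least monotone
  -- extension of the values of `∘` at formulas with negation `⊥`.
  let f : unitInterval → unitInterval := fun z =>
    if z = ⊥ then ⊤ else if M.imp z ⊥ = ⊥ then
      sSup {y | ∃ α, M.imp (h α) ⊥ = ⊥ ∧ h α ≤ z ∧ y = h (circ α)} else ⊥
  have hf : M.IsConsistencyOp f := by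
    refine ⟨fun z => ?_, ?_, by simp [f], fun x y hx hxy => ?_⟩
    · by_cases hz : z = ⊥
      · simp [hz]
      by_cases hz' : M.imp z ⊥ = ⊥
      · simp [hz']
      · simp [f, hz, hz']
    · simp only [f, hne, if_false, M.top_imp, if_true]
      exact top_le_iff.1 (le_sSup ⟨Formula.top, by rw [hformula_top, M.top_imp], le_top,
        hcirc_top.symm⟩)
    · have hx0 : x ≠ ⊥ := by rintro rfl; exact hne (hnbot.symm.trans hx)
      have hy0 : y ≠ ⊥ := by rintro rfl; exact hx0 (le_bot_iff.1 hxy)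
      -- Negation is antitone, so the points with negation `⊥` form an up-set.
      have hy : M.imp y ⊥ = ⊥ := by
        refine le_bot_iff.1 (le_of_le_of_eq ((M.residuation _ _ _).1 ?_) hx)
        exact (M.mul_le_mul_left hxy _).trans ((M.residuation _ y ⊥).2 le_rfl)
      simp only [f, hx0, hy0, hx, hy, if_false, if_true]
      refine sSup_le_sSup ?_
      rintro _ ⟨α, hα, hαx, rfl⟩
      exact ⟨α, hα, hαx.trans hxy, rfl⟩
  have hfh : ∀ α, h (circ α) = f (h α) := by
    intro α
    by_cases h0 : h α = ⊥
    · simp only [f, h0, if_true]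
      rw [hcong α bot (h0.trans hbot.symm), hcirc_bot]
    by_cases h1 : M.imp (h α) ⊥ = ⊥
    · simp only [f, h0, h1, if_true, if_false]
      -- The supremum is attained at `α` itself, by (Coh).
      refine le_antisymm (le_sSup ⟨α, h1, le_rfl, rfl⟩) (sSup_le ?_)
      rintro _ ⟨β, hβ, hβα, rfl⟩
      exact hcoh β α hβ hβα
    · simp only [f, h0, h1, if_false]
      -- In a chain a meet is `⊥` only if one factor is; the first two are not.
      have := hA1 α
      rw [min_eq_bot, min_eq_bot] at this
      tauto
  have heval : ∀ ψ, (M.expand f).eval (fun n => h (var n)) ψ = h ψ := by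
    intro ψ
    induction ψ with
    | var n => rfl
    | bot => exact hbot.symm
    | and α β ihα ihβ => rw [hand, ← ihα, ← ihβ]; rfl
    | conj α β ihα ihβ => rw [hconj, ← ihα, ← ihβ]; rfl
    | imp α β ihα ihβ => rw [himp, ← ihα, ← ihβ]; rfl
    | op c a ih =>
      cases c with
      | none =>
        have ha : op (S := S.withCirc) none a = circ (a (0 : Fin 1)) := by
          refine congrArg _ (funext fun i => congrArg a (Subsingleton.elim (α := Fin 1) _ _))
        rw [ha, hfh]; exact congrArg f (ih _)
      | some c =>
        exact (congrArg (M.op c) (funext ih)).trans (hop c a).symm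
  refine hφP ((htop φ).1 ?_)
  rw [← heval]
  refine hφ _ (hf.isAlgebraOf hM) _ fun ψ hψ => ?_
  rw [heval]
  exact (htop ψ).2 (hTP hψ)

theorem mainTheorem1 (S : Signature.{u}) [Countable S.Op] (L : Logic S)
    (hcore : IsCoreExpansion L) (hsemi : Semilinear L) :
    StrongRealComplete L.withCirc ↔ StrongRealComplete L :=
  ⟨.of_withCirc hsemi, .withCirc hsemi⟩
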